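/- For an integer $a$ let the Dickson polynomials $D_n(x,a)\in\mathbb{Z}[x]$, $n\ge 0$, be defined by $D_0(x,a)=2$, $D_1(x,a)=x$ and $D_n(x,a)=x\,D_{n-1}(x,a)-a\,D_{n-2}(x,a)$ for $n\ge 2$, and let $L_n(x)=D_n(x,-1)$ be the Lucas polynomials. For a finite field $\mathbb{F}_q$ and $f\in\mathbb{Z}[x]$ let the residue sum $$S_q(f)=\sum_{y\in\{f(x)\,:\,x\in\mathbb{F}_q\}} y\in\mathbb{F}_q$$ be the sum of the distinct values of $f$ on $\mathbb{F}_q$. Let $q$ be an odd prime power, $n\ge 0$ an integer, and $a$ an integer with $a\ne 0$ in $\mathbb{F}_q$. If $n$ is odd, then $S_q(D_n(x,a))=0$. If $n$ is even, then $$S_q(D_n(x,a))\in\{0,\ \pm a^{n/2},\ \pm 2a^{n/2}\}\subseteq\mathbb{F}_q .$$ In particular, for every odd prime $p$ and every integer $n\ge 0$, $$S_p(L_n)\in\{-1,0,1,2\}\subseteq\mathbb{F}_p .$$ -/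

import Mathlib

open Polynomial

/-- The Dickson polynomial `D_n(x, a)` with integer parameter `a`: `D_0 = 2`, `D_1 = x` and
`D_n = x D_{n-1} - a D_{n-2}` (Mathlib's Dickson polynomials of the first kind). -/
noncomputable def dicksonPoly (n : ℕ) (a : ℤ) : ℤ[X] := Polynomial.dickson 1 a n

/-- The Lucas polynomial `L_n(x) = D_n(x, -1)`. -/
noncomputable def lucasPoly (n : ℕ) : ℤ[X] := dicksonPoly n (-1)

open Classical in
/-- The set of values `{f(x) : x ∈ F}` of an integral polynomial over a finite field `F`. -/
noncomputable def valueSet (F : Type*) [Field F] [Fintype F] (f : ℤ[X]) : Finset F :=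
  Finset.univ.image fun x : F => aeval x f

/-- The residue sum of `f` over `F`: the sum of the distinct values of `f` on `F`. -/
noncomputable def residueSum (F : Type*) [Field F] [Fintype F] (f : ℤ[X]) : F :=
  ∑ y ∈ valueSet F f, y

theorem dicksonPoly_zero (a : ℤ) : dicksonPoly 0 a = 2 := by
  rw [dicksonPoly, Polynomial.dickson_zero]
  norm_num

theorem dicksonPoly_one (a : ℤ) : dicksonPoly 1 a = X := by
  rw [dicksonPoly, Polynomial.dickson_one]

theorem dicksonPoly_add_two (n : ℕ) (a : ℤ) :
    dicksonPoly (n + 2) a = X * dicksonPoly (n + 1) a - C a * dicksonPoly n a := by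
  simp only [dicksonPoly, Polynomial.dickson_add_two]

/-! For odd `n` the value set is symmetric under negation, so its sum vanishes. For even `n`, write
`x = u + a / u` over the algebraic closure. Then `x` lies in the field of `q` elements iff `u ^ (q -
1) = 1` or `u ^ (q + 1) = a` (`add_div_mem_range_iff`). With `v = u ^ n` the values are `v + a ^ n /
v`, where `v` runs over `M ∪ N`, the `n`-th powers of these two kinds of `u`. Each value comes from
a pair `{v, a ^ n / v}`, so the residue sum is the sum of `M ∪ N` plus the `v` with `v ^ 2 = a ^ n`,
i.e. `v = ±b`, `b = a ^ (n / 2)`. Both `M` and `N` are cosets of finite groups of roots of unity, so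
each is a singleton or has sum zero (`sum_powRoots_eq_zero_or`), and they meet only in `±b`. A
finite case check remains. -/

/-- The identity `D_n(u + a / u, a) = u ^ n + (a / u) ^ n`. -/
theorem aeval_dicksonPoly_add_div {K : Type*} [Field K] (a : ℤ) {u : K} (hu : u ≠ 0) (n : ℕ) :
    aeval (u + a / u) (dicksonPoly n a) = u ^ n + (a / u) ^ n := by
  induction n using Nat.twoStepInduction with
  | zero => simp only [dicksonPoly_zero, map_ofNat, pow_zero]; norm_num
  | one => simp [dicksonPoly_one]
  | more n ih₁ ih₂ =>
    have h : u * (a / u) = (a : K) := by field_simp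
    rw [dicksonPoly_add_two, map_sub, map_mul, map_mul, ih₁, ih₂, aeval_X, aeval_C]
    simp only [eq_intCast]
    generalize (a : K) / u = w at h
    rw [← h]
    ring

theorem aeval_neg_dicksonPoly {R : Type*} [CommRing R] (a : ℤ) (x : R) (n : ℕ) :
    aeval (-x) (dicksonPoly n a) = (-1) ^ n * aeval x (dicksonPoly n a) := by
  induction n using Nat.twoStepInduction with
  | zero => simp only [dicksonPoly_zero, map_ofNat, pow_zero, one_mul]
  | one => simp [dicksonPoly_one]
  | more n ih₁ ih₂ =>
    rw [dicksonPoly_add_two, map_sub, map_mul, map_mul, ih₁, ih₂, map_sub, map_mul, map_mul]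
    simp only [aeval_X, aeval_C]
    ring

theorem two_ne_zero_of_odd_card {F : Type*} [Field F] [Fintype F] (hF : Odd (Fintype.card F)) :
    (2 : F) ≠ 0 := by
  apply Ring.two_ne_zero
  intro h
  exact (Nat.not_even_iff_odd.2 hF)
    (Nat.even_iff.2 (FiniteField.even_card_of_char_two h))

theorem residueSum_dicksonPoly_of_odd {F : Type*} [Field F] [Fintype F]
    (hF : Odd (Fintype.card F)) (a : ℤ) {n : ℕ} (hn : Odd n) :
    residueSum F (dicksonPoly n a) = 0 := by
  classical
  have hmem : ∀ y ∈ valueSet F (dicksonPoly n a), -y ∈ valueSet F (dicksonPoly n a) := by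
    intro y hy
    simp only [valueSet, Finset.mem_image, Finset.mem_univ, true_and] at hy ⊢
    obtain ⟨x, rfl⟩ := hy
    exact ⟨-x, by rw [aeval_neg_dicksonPoly, hn.neg_one_pow]; ring⟩
  have h : residueSum F (dicksonPoly n a) = -residueSum F (dicksonPoly n a) := by
    unfold residueSum
    rw [← Finset.sum_neg_distrib]
    exact Finset.sum_bij' (fun y _ => -y) (fun y _ => -y) hmem hmem (by simp) (by simp) (by simp)
  have h2 : (2 : F) * residueSum F (dicksonPoly n a) = 0 := by linear_combination h
  exact (mul_eq_zero.1 h2).resolve_left (two_ne_zero_of_odd_card hF)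

/-- A set stable under `v ↦ b ^ 2 / v` which is a singleton is `{b}` or `{-b}`. -/
theorem eq_singleton_or_neg {K : Type*} [Field K] {b : K} {M : Finset K} (hM0 : ∀ v ∈ M, v ≠ 0)
    (hM : ∀ v ∈ M, b ^ 2 / v ∈ M) (h : ∃ c, M = {c}) : M = {b} ∨ M = {-b} := by
  obtain ⟨c, rfl⟩ := h
  have h1 := Finset.mem_singleton.1 (hM c (by simp))
  rw [div_eq_iff (hM0 c (by simp)), ← sq] at h1
  rcases sq_eq_sq_iff_eq_or_eq_neg.1 h1.symm with rfl | rfl <;> simp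

/-! ### Sums over sets stable under `v ↦ A / v` -/

section FiniteSums

variable {K : Type*} [Field K] [DecidableEq K]

/-- The distinct values of `v ↦ v + A / v` on a finite set stable under `v ↦ A / v`. -/
theorem sum_image_add_div {A : K} (M : Finset K) (hM0 : ∀ v ∈ M, v ≠ 0)
    (hM : ∀ v ∈ M, A / v ∈ M) :
    ∑ y ∈ M.image (fun v => v + A / v), y = ∑ v ∈ M, v + ∑ v ∈ M with v ^ 2 = A, v := by
  rw [Finset.sum_filter, ← Finset.sum_add_distrib]
  apply Finset.sum_image' (f := fun y : K => y)
  intro v hv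
  have hv0 := hM0 v hv
  -- Fibres are the orbits of `v ↦ A / v`. A two-element orbit sums to its value; a fixed point
  -- contributes only half of its value `2 * v`, hence the correction term.
  have hfib : (M.filter fun w => w + A / w = v + A / v) = {v, A / v} := by
    ext w
    simp only [Finset.mem_filter, Finset.mem_insert, Finset.mem_singleton]
    constructor
    · rintro ⟨hw, h⟩
      have hw0 := hM0 w hw
      have : (w - v) * (w * v - A) = 0 := by
        field_simp at h
        linear_combination h
      rcases mul_eq_zero.1 this with h | h
      · exact .inl (sub_eq_zero.1 h)
      · exact .inr (by rw [eq_div_iff hv0]; exact sub_eq_zero.1 h)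
    · rintro (rfl | rfl)
      · exact ⟨hv, rfl⟩
      · have hA : A ≠ 0 := by
          rintro rfl
          exact hM0 _ (hM v hv) (by simp)
        exact ⟨hM v hv, by field_simp; ring⟩
  rw [hfib]
  by_cases h : v ^ 2 = A
  · have hA : A / v = v := by rw [div_eq_iff hv0, ← h]; ring
    simp [hA, h]
  · have hne : v ≠ A / v := by
      intro h'
      rw [eq_div_iff hv0] at h'
      exact h (by rw [← h']; ring)
    have h' : ¬ (A / v) ^ 2 = A := by
      intro h'
      have hA : A ≠ 0 := by
        rintro rfl
        exact hM0 _ (hM v hv) (by simp)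
      field_simp at h'
      exact h h'.symm
    rw [Finset.sum_pair hne, if_neg h, if_neg h', add_zero, add_zero]

theorem sum_filter_sq_eq_sq {b : K} (hb : b ≠ -b) (M : Finset K) :
    ∑ v ∈ M with v ^ 2 = b ^ 2, v = (if b ∈ M then b else 0) - (if -b ∈ M then b else 0) := by
  have h : (M.filter fun v => v ^ 2 = b ^ 2) = ({b, -b} : Finset K).filter (· ∈ M) := by
    ext v
    simp only [Finset.mem_filter, sq_eq_sq_iff_eq_or_eq_neg, Finset.mem_insert,
      Finset.mem_singleton, and_comm]
  rw [h, Finset.sum_filter, Finset.sum_pair hb]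
  split_ifs <;> ring

/-- The sum of the distinct values of `v ↦ v + b ^ 2 / v` on the union of two stable sets, each of
which is a singleton or has sum zero, and which meet in `{b, -b}`. -/
theorem sum_image_union_eq {b : K} (hb : b ≠ -b) {M N : Finset K} (hM0 : ∀ v ∈ M, v ≠ 0)
    (hN0 : ∀ v ∈ N, v ≠ 0) (hM : ∀ v ∈ M, b ^ 2 / v ∈ M) (hN : ∀ v ∈ N, b ^ 2 / v ∈ N)
    (hMN : ∀ v ∈ M, v ∈ N → v ^ 2 = b ^ 2) :
    ∑ y ∈ (M ∪ N).image (fun v => v + b ^ 2 / v), y = ∑ v ∈ M, v + ∑ v ∈ N, v +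
      ((if b ∈ M ∪ N then b else 0) - (if -b ∈ M ∪ N then b else 0)) -
      ((if b ∈ M ∩ N then b else 0) - (if -b ∈ M ∩ N then b else 0)) := by
  have hinter : ∑ v ∈ M ∩ N, v = ∑ v ∈ M ∩ N with v ^ 2 = b ^ 2, v := by
    rw [Finset.filter_true_of_mem]
    intro v hv
    exact hMN v (Finset.mem_inter.1 hv).1 (Finset.mem_inter.1 hv).2
  rw [sum_image_add_div (M ∪ N), ← Finset.sum_union_inter (s₁ := M) (s₂ := N), hinter,
    sum_filter_sq_eq_sq hb, sum_filter_sq_eq_sq hb]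
  · ring
  · intro v hv
    exact (Finset.mem_union.1 hv).elim (hM0 v) (hN0 v)
  · intro v hv
    exact Finset.mem_union.2 ((Finset.mem_union.1 hv).imp (hM v) (hN v))

/-- The correction is `b` times (`b` lies in exactly one of `M`, `N`) minus (`-b` does), so it is
`0` or `±b`. Two equal singletons cancel it, which rules out `±3b`. -/
theorem sum_image_union_mem {b : K} (hb : b ≠ -b) {M N : Finset K} (hM0 : ∀ v ∈ M, v ≠ 0)
    (hN0 : ∀ v ∈ N, v ≠ 0) (hM : ∀ v ∈ M, b ^ 2 / v ∈ M) (hN : ∀ v ∈ N, b ^ 2 / v ∈ N)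
    (hMN : ∀ v ∈ M, v ∈ N → v ^ 2 = b ^ 2) (hMs : (∑ v ∈ M, v = 0) ∨ ∃ c, M = {c})
    (hNs : (∑ v ∈ N, v = 0) ∨ ∃ c, N = {c}) :
    ∑ y ∈ (M ∪ N).image (fun v => v + b ^ 2 / v), y ∈ ({0, b, -b, 2 * b, -(2 * b)} : Set K) := by
  rw [sum_image_union_eq hb hM0 hN0 hM hN hMN]
  have hb' := hb.symm
  simp only [Finset.mem_union, Finset.mem_inter, Set.mem_insert_iff, Set.mem_singleton_iff]
  rcases hMs.imp_right (eq_singleton_or_neg hM0 hM) with h | h | h <;>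
    rcases hNs.imp_right (eq_singleton_or_neg hN0 hN) with h' | h' | h' <;>
    by_cases h1 : b ∈ M <;> by_cases h2 : -b ∈ M <;> by_cases h3 : b ∈ N <;>
    by_cases h4 : -b ∈ N <;> simp_all [two_mul]

theorem sum_image_union_mem_of_one_mem {b : K} (hb : b ≠ -b) {M N : Finset K}
    (hM0 : ∀ v ∈ M, v ≠ 0)
    (hN0 : ∀ v ∈ N, v ≠ 0) (hM : ∀ v ∈ M, b ^ 2 / v ∈ M) (hN : ∀ v ∈ N, b ^ 2 / v ∈ N)
    (hMN : ∀ v ∈ M, v ∈ N → v ^ 2 = b ^ 2) (hMs : (∑ v ∈ M, v = 0) ∨ ∃ c, M = {c})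
    (hNs : (∑ v ∈ N, v = 0) ∨ ∃ c, N = {c}) (h1M : 1 ∈ M) (hb1 : b = 1 ∨ b = -1) :
    ∑ y ∈ (M ∪ N).image (fun v => v + b ^ 2 / v), y ∈ ({-1, 0, 1, 2} : Set K) := by
  -- Only `b ^ 2` enters the sum, so the sign of `b` is free. Then `1 ∈ M` excludes `M = {-1}`, and
  -- with it the value `-2`.
  wlog hb2 : b = 1 generalizing b
  · obtain rfl : b = -1 := hb1.resolve_left hb2
    simpa using this (b := 1) (by simpa using hb.symm) (by simpa using hM) (by simpa using hN)
      (by simpa using hMN) (.inl rfl) rfl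
  subst hb2
  rw [sum_image_union_eq hb hM0 hN0 hM hN hMN]
  have hb' := hb.symm
  simp only [Finset.mem_union, Finset.mem_inter, Set.mem_insert_iff, Set.mem_singleton_iff]
  rcases hMs.imp_right (eq_singleton_or_neg hM0 hM) with h | h | h <;>
    rcases hNs.imp_right (eq_singleton_or_neg hN0 hN) with h' | h' | h' <;>
    by_cases h2 : -1 ∈ M <;> by_cases h3 : 1 ∈ N <;>
    by_cases h4 : -1 ∈ N <;> simp_all [← one_add_one_eq_two]

/-! ### Powers of the roots of `u ^ m = c` -/

/-- The `n`-th powers of the solutions of `u ^ m = c`. -/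
noncomputable def powRoots (n m : ℕ) (c : K) : Finset K :=
  (nthRoots m c).toFinset.image (· ^ n)

theorem mem_powRoots {n m : ℕ} (hm : 0 < m) {c v : K} :
    v ∈ powRoots n m c ↔ ∃ u, u ^ m = c ∧ u ^ n = v := by
  simp [powRoots, mem_nthRoots hm]

/-- Two distinct elements have ratio `ζ ≠ 1`, the `n`-th power of an `m`-th root of unity.
Multiplication by `ζ` permutes the set, so `(ζ - 1)` kills the sum. -/
theorem sum_powRoots_eq_zero_or [IsAlgClosed K] {n m : ℕ} (hm : 0 < m) {c : K} (hc : c ≠ 0) :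
    (∑ v ∈ powRoots n m c, v = 0) ∨ ∃ d, powRoots n m c = {d} := by
  obtain ⟨u, hu⟩ := IsAlgClosed.exists_pow_nat_eq c hm
  have hu0 : u ≠ 0 := by
    rintro rfl
    exact hc (by rw [← hu, zero_pow hm.ne'])
  by_cases h : ∀ v ∈ powRoots n m c, v = u ^ n
  · exact .inr ⟨u ^ n, Finset.eq_singleton_iff_unique_mem.2 ⟨(mem_powRoots hm).2 ⟨u, hu, rfl⟩, h⟩⟩
  left
  push Not at h
  obtain ⟨v, hv, hne⟩ := h
  obtain ⟨w, hw, rfl⟩ := (mem_powRoots hm).1 hv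
  have hw0 : w ≠ 0 := by
    rintro rfl
    exact hc (by rw [← hw, zero_pow hm.ne'])
  have key : (w / u) ^ n * ∑ v ∈ powRoots n m c, v = ∑ v ∈ powRoots n m c, v := by
    rw [Finset.mul_sum]
    refine Finset.sum_bij' (fun v _ => (w / u) ^ n * v) (fun v _ => (u / w) ^ n * v) ?_ ?_ ?_ ?_ ?_
    · intro v hv
      obtain ⟨z, hz, rfl⟩ := (mem_powRoots hm).1 hv
      refine (mem_powRoots hm).2 ⟨w / u * z, ?_, by rw [mul_pow]⟩
      rw [mul_pow, div_pow, hz, hw, hu, div_self hc, one_mul]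
    · intro v hv
      obtain ⟨z, hz, rfl⟩ := (mem_powRoots hm).1 hv
      refine (mem_powRoots hm).2 ⟨u / w * z, ?_, by rw [mul_pow]⟩
      rw [mul_pow, div_pow, hz, hw, hu, div_self hc, one_mul]
    · intro v _
      rw [← mul_assoc, ← mul_pow, div_mul_div_cancel₀ hw0, div_self hu0, one_pow, one_mul]
    · intro v _
      rw [← mul_assoc, ← mul_pow, div_mul_div_cancel₀ hu0, div_self hw0, one_pow, one_mul]
    · intro v _
      rfl
  have h0 : ((w / u) ^ n - 1) * ∑ v ∈ powRoots n m c, v = 0 := by rw [sub_mul, key]; ring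
  refine (mul_eq_zero.1 h0).resolve_left fun h1 => hne ?_
  rwa [sub_eq_zero, div_pow, div_eq_one_iff_eq (pow_ne_zero n hu0)] at h1

theorem ne_zero_of_mem_powRoots {n m : ℕ} (hm : 0 < m) {c v : K} (hc : c ≠ 0)
    (hv : v ∈ powRoots n m c) : v ≠ 0 := by
  obtain ⟨u, hu, rfl⟩ := (mem_powRoots hm).1 hv
  apply pow_ne_zero
  rintro rfl
  exact hc (by rw [← hu, zero_pow hm.ne'])

theorem div_mem_powRoots {n m : ℕ} (hm : 0 < m) {a c v : K} (hc : c ≠ 0) (ha : a ^ m = c ^ 2)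
    (hv : v ∈ powRoots n m c) : a ^ n / v ∈ powRoots n m c := by
  obtain ⟨u, hu, rfl⟩ := (mem_powRoots hm).1 hv
  exact (mem_powRoots hm).2 ⟨a / u, by rw [div_pow, hu, ha]; field_simp, div_pow ..⟩

end FiniteSums

/-! ### Parametrizing the value set over a finite field -/

section FiniteField

variable {F : Type*} [Field F] [Fintype F] {K : Type*} [Field K] [Algebra F K]

theorem mem_range_algebraMap_iff_pow_card (y : K) :
    y ∈ Set.range (algebraMap F K) ↔ y ^ Fintype.card F = y := by
  constructor
  · rintro ⟨x, rfl⟩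
    rw [← map_pow, FiniteField.pow_card]
  · intro h
    classical
    have hq := Fintype.one_lt_card (α := F)
    have hp : (X ^ Fintype.card F - X : K[X]) ≠ 0 := FiniteField.X_pow_card_sub_X_ne_zero K hq
    have hroot : ∀ z : K, z ∈ (X ^ Fintype.card F - X : K[X]).roots.toFinset ↔
        z ^ Fintype.card F = z := fun z => by
      simp [mem_roots hp, sub_eq_zero]
    have hcard : (X ^ Fintype.card F - X : K[X]).roots.toFinset.card ≤
        (Finset.univ.image (algebraMap F K)).card := by
      rw [Finset.card_image_of_injective _ (algebraMap F K).injective, Finset.card_univ]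
      exact ((Multiset.toFinset_card_le _).trans (card_roots' _)).trans_eq
        (FiniteField.X_pow_card_sub_X_natDegree_eq K hq)
    have heq := Finset.eq_of_subset_of_card_le (fun z hz => by
      obtain ⟨x, -, rfl⟩ := Finset.mem_image.1 hz
      rw [hroot, ← map_pow, FiniteField.pow_card]) hcard
    obtain ⟨x, -, hx⟩ := Finset.mem_image.1 (heq ▸ (hroot y).2 h)
    exact ⟨x, hx⟩

theorem pow_card_intCast (a : ℤ) : (a : K) ^ Fintype.card F = a := by
  have := congrArg (algebraMap F K) (FiniteField.pow_card (a : F))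
  simpa using this

/-- Being fixed by the `q`-Frobenius becomes, after clearing denominators, `(u ^ (q - 1) - 1) * (u ^
(q + 1) - a) = 0`. -/
theorem add_div_mem_range_iff (a : ℤ) {u : K} (hu : u ≠ 0) :
    u + a / u ∈ Set.range (algebraMap F K) ↔
      u ^ (Fintype.card F - 1) = 1 ∨ u ^ (Fintype.card F + 1) = a := by
  obtain ⟨p, hp⟩ := CharP.exists F
  obtain ⟨k, hprime, hk⟩ := FiniteField.card F p
  have : Fact p.Prime := ⟨hprime⟩
  have : CharP K p := charP_of_injective_algebraMap (algebraMap F K).injective p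
  have hadd : (u + a / u) ^ Fintype.card F = u ^ Fintype.card F + a / u ^ Fintype.card F := by
    have : (u + a / u) ^ Fintype.card F = u ^ Fintype.card F + (a / u) ^ Fintype.card F := by
      rw [hk]; exact add_pow_char_pow ..
    rw [this, div_pow, pow_card_intCast]
  obtain ⟨m, hm⟩ : ∃ m, Fintype.card F = m + 1 :=
    ⟨Fintype.card F - 1, by have := Fintype.card_pos (α := F); omega⟩
  rw [mem_range_algebraMap_iff_pow_card, hadd, hm, Nat.add_sub_cancel]
  have hum := pow_ne_zero m hu
  rw [← sub_eq_zero (a := u ^ m), ← sub_eq_zero (a := u ^ (m + 1 + 1)), ← mul_eq_zero,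
    ← sub_eq_zero (a := u ^ (m + 1) + _)]
  have : u ^ (m + 1) + a / u ^ (m + 1) - (u + a / u) =
      (u ^ m - 1) * (u ^ (m + 1 + 1) - a) / u ^ (m + 1) := by
    field_simp
    ring
  rw [this, div_eq_zero_iff, or_iff_left (pow_ne_zero _ hu)]

/-- The value set of `D_n(x, a)` parametrized through `x = u + a / u`. -/
theorem image_valueSet_dicksonPoly [IsAlgClosed K] [DecidableEq K] {a : ℤ} (ha : (a : K) ≠ 0)
    (n : ℕ) :
    (valueSet F (dicksonPoly n a)).image (algebraMap F K) =
      (powRoots n (Fintype.card F - 1) (1 : K) ∪ powRoots n (Fintype.card F + 1) (a : K)).image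
        (fun v => v + (a : K) ^ n / v) := by
  have hq : 0 < Fintype.card F - 1 := by have := Fintype.one_lt_card (α := F); omega
  ext y
  simp only [valueSet, Finset.mem_image, Finset.mem_univ, true_and, Finset.mem_union,
    mem_powRoots hq, mem_powRoots (Nat.succ_pos _)]
  constructor
  · rintro ⟨_, ⟨x, rfl⟩, rfl⟩
    obtain ⟨u, hu⟩ := IsAlgClosed.exists_root
      (C 1 * X ^ 2 + C (-algebraMap F K x) * X + C (a : K))
      (by rw [degree_quadratic one_ne_zero]; norm_num)
    have hu' : u ^ 2 - algebraMap F K x * u + a = 0 := by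
      simp [IsRoot] at hu
      linear_combination hu
    have hu0 : u ≠ 0 := by
      rintro rfl
      exact ha (by simpa using hu')
    have hx : u + a / u = algebraMap F K x := by
      field_simp
      linear_combination hu'
    refine ⟨u ^ n, ?_, ?_⟩
    · exact ((add_div_mem_range_iff a hu0).1 ⟨x, hx.symm⟩).imp
        (fun h => ⟨u, h, rfl⟩) (fun h => ⟨u, h, rfl⟩)
    · rw [← div_pow, ← aeval_dicksonPoly_add_div a hu0, hx, aeval_algebraMap_apply]
  · rintro ⟨v, hv, rfl⟩
    obtain ⟨u, hu, rfl⟩ : ∃ u : K,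
        (u ^ (Fintype.card F - 1) = 1 ∨ u ^ (Fintype.card F + 1) = a) ∧ u ^ n = v := by
      rcases hv with ⟨u, h, rfl⟩ | ⟨u, h, rfl⟩
      exacts [⟨u, .inl h, rfl⟩, ⟨u, .inr h, rfl⟩]
    have hu0 : u ≠ 0 := by
      rintro rfl
      rcases hu with h | h
      · simp [hq.ne'] at h
      · exact ha (by simpa using h.symm)
    obtain ⟨x, hx⟩ := (add_div_mem_range_iff (F := F) a hu0).2 hu
    exact ⟨_, ⟨x, rfl⟩, by
      rw [← aeval_algebraMap_apply, hx, aeval_dicksonPoly_add_div a hu0, div_pow]⟩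

theorem algebraMap_residueSum [DecidableEq K] (f : ℤ[X]) :
    algebraMap F K (residueSum F f) = ∑ y ∈ (valueSet F f).image (algebraMap F K), y := by
  rw [residueSum, map_sum, Finset.sum_image fun x _ y _ h => (algebraMap F K).injective h]

theorem residueSum_dicksonPoly_two_mul {F : Type*} [Field F] [Fintype F]
    (hF : Odd (Fintype.card F)) {a : ℤ} (ha : (a : F) ≠ 0) (k : ℕ) :
    residueSum F (dicksonPoly (2 * k) a) ∈
      ({0, (a : F) ^ k, -(a : F) ^ k, 2 * (a : F) ^ k, -(2 * (a : F) ^ k)} : Set F) ∧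
    (a = -1 → residueSum F (dicksonPoly (2 * k) a) ∈ ({-1, 0, 1, 2} : Set F)) := by
  classical
  let K := AlgebraicClosure F
  have hinj := (algebraMap F K).injective
  have haK : (a : K) ≠ 0 := by
    have := (map_ne_zero (algebraMap F K)).2 ha
    simpa using this
  have h2K : (2 : K) ≠ 0 := by
    have := (map_ne_zero (algebraMap F K)).2 (two_ne_zero_of_odd_card hF)
    rwa [map_ofNat] at this
  have hb : (a : K) ^ k ≠ -(a : K) ^ k := by
    intro h
    have : 2 * (a : K) ^ k = 0 := by linear_combination h
    exact (mul_ne_zero h2K (pow_ne_zero k haK)) this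
  have hsq : (a : K) ^ (2 * k) = ((a : K) ^ k) ^ 2 := by ring
  have hq : 0 < Fintype.card F - 1 := by have := Fintype.one_lt_card (α := F); omega
  have hq' : 0 < Fintype.card F + 1 := Nat.succ_pos _
  have ha1 : (a : K) ^ (Fintype.card F - 1) = 1 ^ 2 := by
    have := congrArg (algebraMap F K) (FiniteField.pow_card_sub_one_eq_one (a : F) ha)
    simpa using this
  have ha2 : (a : K) ^ (Fintype.card F + 1) = (a : K) ^ 2 := by
    rw [pow_succ, pow_card_intCast (F := F), sq]
  -- A common element has `v ^ (q - 1) = 1` and `v ^ (q + 1) = a ^ (2 * k)`; divide.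
  have hinter : ∀ v ∈ powRoots (2 * k) (Fintype.card F - 1) (1 : K),
      v ∈ powRoots (2 * k) (Fintype.card F + 1) (a : K) → v ^ 2 = ((a : K) ^ k) ^ 2 := by
    intro v h1 h2
    obtain ⟨u, hu, rfl⟩ := (mem_powRoots hq).1 h1
    obtain ⟨w, hw, hwu⟩ := (mem_powRoots hq').1 h2
    have e1 : (u ^ (2 * k)) ^ (Fintype.card F - 1) = 1 := by
      rw [← pow_mul, mul_comm, pow_mul, hu, one_pow]
    have e2 : (u ^ (2 * k)) ^ (Fintype.card F + 1) = (a : K) ^ (2 * k) := by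
      rw [← hwu, ← pow_mul, mul_comm, pow_mul, hw]
    rw [← hsq, ← e2, show Fintype.card F + 1 = (Fintype.card F - 1) + 2 by omega, pow_add, e1,
      one_mul]
  have hM0 := fun v => ne_zero_of_mem_powRoots (n := 2 * k) (v := v) hq (one_ne_zero (α := K))
  have hN0 := fun v => ne_zero_of_mem_powRoots (n := 2 * k) (v := v) hq' haK
  have hM := fun v => div_mem_powRoots (n := 2 * k) (v := v) hq one_ne_zero ha1
  have hN := fun v => div_mem_powRoots (n := 2 * k) (v := v) hq' haK ha2
  have hMs := sum_powRoots_eq_zero_or (n := 2 * k) hq (one_ne_zero (α := K))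
  have hNs := sum_powRoots_eq_zero_or (n := 2 * k) hq' haK
  have hsum := algebraMap_residueSum (F := F) (K := K) (dicksonPoly (2 * k) a)
  rw [image_valueSet_dicksonPoly haK] at hsum
  rw [hsq] at hsum hM hN
  constructor
  · have h := sum_image_union_mem hb hM0 hN0 hM hN hinter hMs hNs
    rw [← hsum] at h
    simp only [Set.mem_insert_iff, Set.mem_singleton_iff] at h ⊢
    rw [← hinj.eq_iff, ← hinj.eq_iff, ← hinj.eq_iff, ← hinj.eq_iff, ← hinj.eq_iff]
    simpa only [map_zero, map_neg, map_mul, map_pow, map_intCast, map_ofNat, map_one] using h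
  · rintro rfl
    have h := sum_image_union_mem_of_one_mem hb hM0 hN0 hM hN hinter hMs hNs
      ((mem_powRoots hq).2 ⟨1, one_pow _, one_pow _⟩) (by simpa using neg_one_pow_eq_or K k)
    rw [← hsum] at h
    simp only [Set.mem_insert_iff, Set.mem_singleton_iff] at h ⊢
    rw [← hinj.eq_iff, ← hinj.eq_iff, ← hinj.eq_iff, ← hinj.eq_iff]
    simpa only [map_zero, map_neg, map_mul, map_pow, map_intCast, map_ofNat, map_one] using h

end FiniteField

theorem mainTheorem2 :
    (∀ (F : Type*) [Field F] [Fintype F], Odd (Fintype.card F) →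
      ∀ (n : ℕ) (a : ℤ), (a : F) ≠ 0 →
        (Odd n → residueSum F (dicksonPoly n a) = 0) ∧
        (Even n → residueSum F (dicksonPoly n a) ∈
          ({0, (a : F) ^ (n / 2), -(a : F) ^ (n / 2),
            2 * (a : F) ^ (n / 2), -(2 * (a : F) ^ (n / 2))} : Set F))) ∧
    (∀ (p : ℕ) [Fact p.Prime], Odd p → ∀ n : ℕ,
      residueSum (ZMod p) (lucasPoly n) ∈ ({-1, 0, 1, 2} : Set (ZMod p))) := by
  refine ⟨fun F _ _ hF n a ha => ⟨residueSum_dicksonPoly_of_odd hF a, fun hn => ?_⟩,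
    fun p _ hp n => ?_⟩
  · obtain ⟨k, rfl⟩ := hn.two_dvd
    rw [Nat.mul_div_cancel_left k two_pos]
    exact (residueSum_dicksonPoly_two_mul hF ha k).1
  · have hF : Odd (Fintype.card (ZMod p)) := by rwa [ZMod.card]
    rcases Nat.even_or_odd n with hn | hn
    · obtain ⟨k, rfl⟩ := hn.two_dvd
      exact (residueSum_dicksonPoly_two_mul hF (by simp) k).2 rfl
    · rw [lucasPoly, residueSum_dicksonPoly_of_odd hF _ hn]
      simp
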